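/- For a monoid $M$ and $x,y\in M$ write $x\sim_p y$ if there are $u,v\in M$ with $x=uv$ and $y=vu$; let $\sim_p^*$ be the transitive closure of $\sim_p$; and write $x\sim_o y$ if there are $g,h\in M$ with $xg=gy$ and $hx=yh$. A monoid presentation $\langle A\mid R\rangle$ is homogeneous if $|u|=|v|$ for every $(u,v)\in R$, and a monoid is homogeneous if it can be defined by a homogeneous presentation. In the class of homogeneous monoids, $\sim_p^*$ and $\sim_o$ do not coincide in general: there is a homogeneous monoid $M$ on which $\sim_p^*$ and $\sim_o$ are different relations. Moreover: (a) If $\langle A\mid R\rangle$ is a homogeneous presentation with $A$ finite and $R\subseteq A^*\times A^*$ a decidable set (for instance, finite), then there is an algorithm that takes two words over $A$ and decides whether the elements of the monoid $\langle A\mid R\rangle$ which they represent are $\sim_p^*$-related. (b) There is a finite homogeneous presentation $\langle A\mid R\rangle$ (that is, $A$ and $R$ are finite) for which no algorithm takes two words over $A$ and decides whether the elements of the monoid $\langle A\mid R\rangle$ which they represent are $\sim_o$-related. -/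

import Mathlib

universe u

/-- Primary conjugacy in a monoid (where `M¹ = M`): `x = u v` and `y = v u` for some `u`, `v`. -/
def PrimaryConj {M : Type u} [Monoid M] (x y : M) : Prop :=
  ∃ a b : M, x = a * b ∧ y = b * a

/-- The relation `∼_p^*`: the transitive closure of primary conjugacy. -/
def PrimaryConjStar {M : Type u} [Monoid M] : M → M → Prop :=
  Relation.TransGen PrimaryConj

/-- The relation `∼_o` in a monoid (where `M¹ = M`). -/
def OConj {M : Type u} [Monoid M] (x y : M) : Prop :=
  ∃ g h : M, x * g = g * y ∧ h * x = y * h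

/-- The presentation `⟨A | rels⟩` is homogeneous: the two sides of each defining relation have
the same length. -/
def IsHomogeneousPresentation {A : Type u} (rels : FreeMonoid A → FreeMonoid A → Prop) : Prop :=
  ∀ v w : FreeMonoid A, rels v w → v.length = w.length

/-- A monoid is homogeneous if it can be defined by a homogeneous presentation. -/
def IsHomogeneousMonoid (M : Type u) [Monoid M] : Prop :=
  ∃ (A : Type u) (rels : FreeMonoid A → FreeMonoid A → Prop),
    IsHomogeneousPresentation rels ∧ Nonempty (M ≃* PresentedMonoid rels)

/-- The element of `⟨A | rels⟩` represented by a word over `A`. -/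
def wordElt {A : Type u} (rels : FreeMonoid A → FreeMonoid A → Prop) (w : List A) :
    PresentedMonoid rels :=
  PresentedMonoid.mk rels (FreeMonoid.ofList w)

/-- The set of defining relations is decidable, as a set of pairs of words over `A`. -/
def HasDecidableRelations {A : Type u} [Primcodable A]
    (rels : FreeMonoid A → FreeMonoid A → Prop) : Prop :=
  ComputablePred fun p : List A × List A => rels (FreeMonoid.ofList p.1) (FreeMonoid.ofList p.2)

/-- Some algorithm, given two words over `A`, decides whether the elements of `⟨A | rels⟩` that
they represent are `∼_p^*`-related. -/
def PrimaryConjStarDecidable {A : Type u} [Primcodable A]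
    (rels : FreeMonoid A → FreeMonoid A → Prop) : Prop :=
  ComputablePred fun p : List A × List A =>
    PrimaryConjStar (wordElt rels p.1) (wordElt rels p.2)

/-- Some algorithm, given two words over `A`, decides whether the elements of `⟨A | rels⟩` that
they represent are `∼_o`-related. -/
def OConjDecidable {A : Type u} [Primcodable A]
    (rels : FreeMonoid A → FreeMonoid A → Prop) : Prop :=
  ComputablePred fun p : List A × List A => OConj (wordElt rels p.1) (wordElt rels p.2)

/-! Decidability in (a) comes from finiteness. On words, `∼_p^*` is the equivalence generated by two
moves, rotating one letter to the end and rewriting a prefix by a defining relation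
(`primaryConjStar_iff_eqvGen_conjStep`). In a homogeneous presentation both moves preserve length,
so a class consists of words of one length over a finite alphabet. Balls around a word are
computable, grow inside a finite set, and equal the class as soon as two consecutive ones agree.

For (b), take a Turing machine with undecidable halting problem and a finite, non-homogeneous
presentation `S` in which the word of an initial configuration equals a fixed halting word iff the
machine halts (`wordElt_configWord_eq_haltWord_iff`). A central letter `pad` then evens out the
lengths of the relations, and a free letter `bar` turns `∼_o` into equality: when `bar u pad^m` and
`bar v pad^n` have equal length, they are `∼_o`-related iff `u = v` holds in `⟨α | S⟩`
(`oConj_barWord_iff`). Deciding `∼_o` would thus decide halting.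

The relations differ on the monoid of (b): if they agreed there, (a) would decide `∼_o`. -/

theorem wordElt_append {A : Type*} (rels : FreeMonoid A → FreeMonoid A → Prop) (u v : List A) :
    wordElt rels (u ++ v) = wordElt rels u * wordElt rels v := by
  simp [wordElt, FreeMonoid.ofList_append]

theorem wordElt_infix_congr {A : Type*} {rels : FreeMonoid A → FreeMonoid A → Prop}
    {u v : List A} (h : wordElt rels u = wordElt rels v) (p s : List A) :
    wordElt rels (p ++ (u ++ s)) = wordElt rels (p ++ (v ++ s)) := by
  simp only [wordElt_append, h]

theorem wordElt_eq_of_rel {A : Type*} {rels : FreeMonoid A → FreeMonoid A → Prop}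
    {u v : List A} (h : rels (.ofList u) (.ofList v)) (p s : List A) :
    wordElt rels (p ++ (u ++ s)) = wordElt rels (p ++ (v ++ s)) :=
  wordElt_infix_congr (PresentedMonoid.mk_eq_mk_of_rel h) p s

theorem Function.End.mul_apply {α : Type*} (f g : Function.End α) (x : α) :
    (f * g) x = f (g x) := rfl

/-! ### Folds, searches and filters with a merely computable step -/

section ComputableLists

/-- Looking letters up by index turns a fold into recursion on a number, the form that
`Computable.nat_rec` accepts. -/
theorem List.foldl_take_eq_rec {β σ : Type*} (h : σ → β → σ) (s : σ) (l : List β) (n : ℕ) :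
    (l.take n).foldl h s = Nat.rec (motive := fun _ => σ) s
      (fun i acc => Option.casesOn (motive := fun _ => σ) (l[i]?) acc (fun b => h acc b)) n := by
  induction n with
  | zero => rfl
  | succ n ih =>
    rw [List.take_add_one, List.foldl_append, ih]
    dsimp only
    cases l[n]? <;> rfl

variable {α β σ : Type*} [Primcodable α] [Primcodable β] [Primcodable σ]

theorem Computable.list_foldr {f : α → List β} {g : α → σ} {h : α → β × σ → σ}
    (hf : Computable f) (hg : Computable g) (hh : Computable₂ h) :
    Computable fun a => (f a).foldr (fun b s => h a (b, s)) (g a) := by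
  have key : Computable fun a => (Nat.rec (motive := fun _ => σ) (g a)
      (fun i acc => Option.casesOn (motive := fun _ => σ) ((f a).reverse[i]?) acc
        (fun b => h a (b, acc))) (f a).length : σ) := by
    refine Computable.nat_rec (h := fun a (p : ℕ × σ) =>
      Option.casesOn (motive := fun _ => σ) ((f a).reverse[p.1]?) p.2
        (fun b => h a (b, p.2))) (Computable.list_length.comp hf) hg ?_
    refine Computable.option_casesOn (o := fun q : α × ℕ × σ => (f q.1).reverse[q.2.1]?)
      (f := fun q : α × ℕ × σ => q.2.2) (g := fun (q : α × ℕ × σ) b => h q.1 (b, q.2.2))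
      (Computable.list_getElem?.comp
        (Computable.list_reverse.comp (hf.comp Computable.fst))
        (Computable.fst.comp Computable.snd))
      (Computable.snd.comp Computable.snd) ?_
    exact hh.comp (Computable.fst.comp Computable.fst)
      (Computable.snd.pair (Computable.snd.comp (Computable.snd.comp Computable.fst)))
  refine key.of_eq fun a => ?_
  rw [← List.foldl_take_eq_rec (fun s b => h a (b, s)), ← List.length_reverse, List.take_length,
    List.foldl_reverse]

theorem Computable.list_any {f : α → List β} {p : α → β → Bool} (hf : Computable f)
    (hp : Computable₂ p) : Computable fun a => (f a).any (p a) := by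
  refine (Computable.list_foldr (h := fun a (q : β × Bool) => p a q.1 || q.2) hf
    (Computable.const false) ?_).of_eq fun a => ?_
  · exact (Primrec.or.to_comp).comp
      (hp.comp Computable.fst (Computable.fst.comp Computable.snd))
      (Computable.snd.comp Computable.snd)
  · induction f a with
    | nil => rfl
    | cons b l ih => rw [List.foldr_cons, ih, List.any_cons]

theorem Computable.list_filter {f : α → List β} {p : α → β → Bool} (hf : Computable f)
    (hp : Computable₂ p) : Computable fun a => (f a).filter (p a) := by
  refine (Computable.list_foldr (h := fun a (q : β × List β) =>
    bif p a q.1 then q.1 :: q.2 else q.2) hf (Computable.const []) ?_).of_eq fun a => ?_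
  · exact Computable.cond (hp.comp Computable.fst (Computable.fst.comp Computable.snd))
      (Computable.list_cons.comp (Computable.fst.comp Computable.snd)
        (Computable.snd.comp Computable.snd))
      (Computable.snd.comp Computable.snd)
  · induction f a with
    | nil => rfl
    | cons b l ih =>
      rw [List.foldr_cons, ih, List.filter_cons]
      cases p a b <;> rfl

end ComputableLists

/-! ### Primary conjugacy as a rewriting process on words -/

section ConjSteps

variable {A : Type} (rels : FreeMonoid A → FreeMonoid A → Prop)

/-- The elementary steps on words that generate `∼_p^*`: move the first letter to the end, or
replace a prefix using a defining relation. -/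
def ConjStep (w w' : List A) : Prop :=
  w' = w.tail ++ w.take 1 ∨ ∃ k < w.length + 1, w.drop k = w'.drop k ∧
    rels (FreeMonoid.ofList (w.take k)) (FreeMonoid.ofList (w'.take k))

variable {rels}

theorem ConjStep.length_eq (hR : IsHomogeneousPresentation rels) {w w' : List A}
    (h : ConjStep rels w w') : w.length = w'.length := by
  rcases h with rfl | ⟨k, -, hd, hr⟩
  · cases w <;> simp
  · have h₁ : (w.take k).length = (w'.take k).length := hR _ _ hr
    rw [← List.take_append_drop k w, ← List.take_append_drop k w', List.length_append,
      List.length_append, h₁, hd]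

theorem eqvGen_conjStep_length_eq (hR : IsHomogeneousPresentation rels) {w w' : List A}
    (h : Relation.EqvGen (ConjStep rels) w w') : w.length = w'.length := by
  induction h with
  | rel _ _ h => exact h.length_eq hR
  | refl _ => rfl
  | symm _ _ _ ih => exact ih.symm
  | trans _ _ _ _ _ ih₁ ih₂ => exact ih₁.trans ih₂

instance PrimaryConj.instSymm {M : Type*} [Monoid M] :
    Std.Symm (PrimaryConj : M → M → Prop) :=
  ⟨fun _ _ ⟨a, b, hx, hy⟩ => ⟨b, a, hy, hx⟩⟩

theorem PrimaryConjStar.refl {M : Type*} [Monoid M] (x : M) : PrimaryConjStar x x :=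
  .single ⟨1, x, (one_mul x).symm, (mul_one x).symm⟩

theorem ConjStep.primaryConjStar {w w' : List A} (h : ConjStep rels w w') :
    PrimaryConjStar (wordElt rels w) (wordElt rels w') := by
  rcases h with rfl | ⟨k, -, hd, hr⟩
  · cases w with
    | nil => exact .refl _
    | cons a w => exact .single ⟨wordElt rels [a], wordElt rels w, wordElt_append rels [a] w,
        wordElt_append rels w [a]⟩
  · have : wordElt rels w = wordElt rels w' := by
      have h' := wordElt_eq_of_rel hr [] (w.drop k)
      rwa [List.nil_append, List.nil_append, List.take_append_drop, hd,
        List.take_append_drop] at h'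
    rw [this]
    exact .refl _

theorem eqvGen_conjStep_append_comm (p q : List A) :
    Relation.EqvGen (ConjStep rels) (p ++ q) (q ++ p) := by
  induction p generalizing q with
  | nil => rw [List.append_nil]; exact .refl _
  | cons a p ih =>
    have h := ih (q ++ [a])
    rw [List.append_assoc, List.singleton_append, ← List.append_assoc] at h
    exact .trans _ _ _ (.rel _ _ (Or.inl rfl)) h

variable (rels) in
/-- The words that are related by elementary steps in every context. -/
def conjStepCon : Con (FreeMonoid A) where
  r u v := ∀ p q : List A, Relation.EqvGen (ConjStep rels) (p ++ (u.toList ++ q))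
    (p ++ (v.toList ++ q))
  iseqv :=
    { refl := fun _ _ _ => .refl _
      symm := fun h p q => .symm _ _ (h p q)
      trans := fun h h' p q => .trans _ _ _ (h p q) (h' p q) }
  mul' := by
    intro u u' v v' h h' p q
    have h₁ := h p (v.toList ++ q)
    have h₂ := h' (p ++ u'.toList) q
    rw [FreeMonoid.toList_mul, FreeMonoid.toList_mul, List.append_assoc, List.append_assoc]
    rw [List.append_assoc, List.append_assoc] at h₂
    exact .trans _ _ _ h₁ h₂

/-- A relation applied inside `p x q` becomes a prefix rewriting once `p` is rotated to the end;
rotating back gives `p y q`. So the congruence `conjStepCon` contains the defining relations, hence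
all of `conGen rels`. Homogeneity lets one cut position serve for both sides. -/
theorem eqvGen_conjStep_of_wordElt_eq (hR : IsHomogeneousPresentation rels) {u v : List A} (h : wordElt rels u = wordElt rels v) :
    Relation.EqvGen (ConjStep rels) u v := by
  have hle : conGen rels ≤ conjStepCon rels := by
    refine Con.conGen_le.2 fun x y hxy p q => ?_
    have hlen : x.toList.length = y.toList.length := hR x y hxy
    refine .trans _ _ _ (eqvGen_conjStep_append_comm _ _)
      (.trans _ _ _ (.rel _ ((y.toList ++ q) ++ p) (Or.inr ⟨x.toList.length, ?_, ?_, ?_⟩))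
        (eqvGen_conjStep_append_comm _ _))
    · simp only [List.length_append]
      omega
    · rw [List.append_assoc, List.append_assoc, List.drop_left, hlen, List.drop_left]
    · rw [List.append_assoc, List.append_assoc, List.take_left, hlen, List.take_left]
      exact hxy
  simpa using hle (PresentedMonoid.mk_eq_mk_iff.1 h) [] []

theorem eqvGen_conjStep_of_primaryConj (hR : IsHomogeneousPresentation rels) {u v : List A}
    (h : PrimaryConj (wordElt rels u) (wordElt rels v)) :
    Relation.EqvGen (ConjStep rels) u v := by
  obtain ⟨a, b, hu, hv⟩ := h
  obtain ⟨p, rfl⟩ := PresentedMonoid.surjective_mk a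
  obtain ⟨q, rfl⟩ := PresentedMonoid.surjective_mk b
  rw [← map_mul] at hu hv
  exact .trans _ _ _ (eqvGen_conjStep_of_wordElt_eq hR (v := p.toList ++ q.toList) hu)
    (.trans _ _ _ (eqvGen_conjStep_append_comm _ _)
      (eqvGen_conjStep_of_wordElt_eq hR (u := q.toList ++ p.toList) hv.symm))

theorem primaryConjStar_iff_eqvGen_conjStep (hR : IsHomogeneousPresentation rels)
    {u v : List A} :
    PrimaryConjStar (wordElt rels u) (wordElt rels v) ↔
      Relation.EqvGen (ConjStep rels) u v := by
  constructor
  · intro h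
    -- The intermediate elements of a chain are not given by words, so the induction runs over
    -- elements and allows every representing word.
    have key : ∀ y, PrimaryConjStar (wordElt rels u) y → ∀ v, wordElt rels v = y →
        Relation.EqvGen (ConjStep rels) u v := by
      intro y hy
      induction hy with
      | single h => rintro v rfl; exact eqvGen_conjStep_of_primaryConj hR h
      | @tail y z _ h ih =>
        rintro v rfl
        obtain ⟨w, rfl⟩ := PresentedMonoid.surjective_mk y
        exact .trans _ _ _ (ih w.toList rfl)
          (eqvGen_conjStep_of_primaryConj hR (u := w.toList) h)
    exact key _ h v rfl
  · intro h
    induction h with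
    | rel _ _ h => exact h.primaryConjStar
    | refl _ => exact .refl _
    | symm _ _ _ ih => exact Relation.TransGen.stdSymm.symm _ _ ih
    | trans _ _ _ _ _ ih₁ ih₂ => exact ih₁.trans ih₂

end ConjSteps

/-! ### Deciding `∼_p^*` by growing balls of words -/

section WordsOfLength

variable {A : Type} [Finite A]

variable (A) in
/-- A list of the words of a given length over a finite alphabet. -/
noncomputable def wordsOfLength (n : ℕ) : List (List A) :=
  letI := Fintype.ofFinite A
  Nat.rec (motive := fun _ => List (List A)) [[]]
    (fun _ W => (Finset.univ : Finset A).toList.flatMap fun a => W.map (List.cons a)) n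

theorem mem_wordsOfLength {n : ℕ} {w : List A} : w ∈ wordsOfLength A n ↔ w.length = n := by
  induction n generalizing w with
  | zero => simp [wordsOfLength]
  | succ n ih =>
    simp only [wordsOfLength, List.mem_flatMap, Finset.mem_toList, Finset.mem_univ, true_and,
      List.mem_map] at ih ⊢
    constructor
    · rintro ⟨a, w, hw, rfl⟩
      rw [List.length_cons, ih.1 hw]
    · intro h
      cases w with
      | nil => simp at h
      | cons a w => exact ⟨a, w, ih.2 (by simpa using h), rfl⟩

end WordsOfLength

section Decision

variable {A : Type} [Primcodable A]

/-- The Boolean version of `ConjStep`. -/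
noncomputable def conjStepBool (r : List A × List A → Bool) (w w' : List A) : Bool :=
  letI := Encodable.decidableEqOfEncodable A
  decide (w' = w.tail ++ w.take 1) || (List.range (w.length + 1)).any fun k =>
    decide (w.drop k = w'.drop k) && r (w.take k, w'.take k)

theorem conjStepBool_iff {rels : FreeMonoid A → FreeMonoid A → Prop}
    {r : List A × List A → Bool}
    (hr : ∀ p, rels (FreeMonoid.ofList p.1) (FreeMonoid.ofList p.2) ↔ r p = true)
    (w w' : List A) : conjStepBool r w w' = true ↔ ConjStep rels w w' := by
  have hr' : ∀ a b, rels (FreeMonoid.ofList a) (FreeMonoid.ofList b) ↔ r (a, b) = true :=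
    fun a b => hr (a, b)
  simp [conjStepBool, ConjStep, hr']

theorem computable₂_conjStepBool {r : List A × List A → Bool} (hr : Computable r) :
    Computable₂ (conjStepBool r) := by
  let _ := Encodable.decidableEqOfEncodable A
  have hw : Primrec fun p : (List A × List A) × ℕ => p.1.1 := Primrec.fst.comp Primrec.fst
  have hw' : Primrec fun p : (List A × List A) × ℕ => p.1.2 := Primrec.snd.comp Primrec.fst
  refine Primrec.or.to_comp.comp (Primrec.to_comp ?_) (Computable.list_any (Primrec.to_comp ?_) ?_)
  · exact (Primrec.eq.comp Primrec.snd (Primrec.list_append.comp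
      (Primrec.list_tail.comp Primrec.fst)
      (Primrec.list_take.comp (Primrec.const 1) Primrec.fst))).decide
  · exact Primrec.list_range.comp (Primrec.succ.comp (Primrec.list_length.comp Primrec.fst))
  · refine Primrec.and.to_comp.comp (Primrec.to_comp ?_) (hr.comp (Primrec.to_comp ?_))
    · exact (Primrec.eq.comp (Primrec.list_drop.comp Primrec.snd hw)
        (Primrec.list_drop.comp Primrec.snd hw')).decide
    · exact (Primrec.list_take.comp Primrec.snd hw).pair (Primrec.list_take.comp Primrec.snd hw')

variable [Finite A]

theorem primrec_wordsOfLength : Primrec (wordsOfLength A) := by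
  refine Primrec.nat_rec₁ [[]] (f := fun _ W => _) ?_
  exact (Primrec.list_flatMap (Primrec.const _) (Primrec.list_map
    (Primrec.snd.comp Primrec.fst) (Primrec.list_cons.comp
      (Primrec.snd.comp Primrec.fst) Primrec.snd).to₂).to₂).to₂

/-- The words of length `n` that agree with, or are one elementary step away from, a word of the
list `W`. -/
noncomputable def conjNeighbours (r : List A × List A → Bool) (n : ℕ) (W : List (List A)) :
    List (List A) :=
  letI := Encodable.decidableEqOfEncodable A
  (wordsOfLength A n).filter fun w' => W.any fun w =>
    decide (w = w') || (conjStepBool r w w' || conjStepBool r w' w)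

/-- The words of the length of `u` that are reached from `u` by at most `k` elementary steps. -/
noncomputable def conjBall (r : List A × List A → Bool) (u : List A) (k : ℕ) : List (List A) :=
  Nat.rec (motive := fun _ => List (List A)) [u] (fun _ W => conjNeighbours r u.length W) k

theorem computable_conjNeighbours {r : List A × List A → Bool} (hr : Computable r) :
    Computable₂ (conjNeighbours r) := by
  let _ := Encodable.decidableEqOfEncodable A
  have hs := computable₂_conjStepBool hr
  have hw' : Computable fun p : ((ℕ × List (List A)) × List A) × List A => p.1.2 :=
    Computable.snd.comp Computable.fst
  refine Computable.list_filter (primrec_wordsOfLength.to_comp.comp Computable.fst)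
    (Computable.list_any (Computable.snd.comp Computable.fst) ?_)
  refine Primrec.or.to_comp.comp (Primrec.to_comp ?_)
    (Primrec.or.to_comp.comp (hs.comp Computable.snd hw') (hs.comp hw' Computable.snd))
  exact (Primrec.eq.comp Primrec.snd (Primrec.snd.comp Primrec.fst)).decide

theorem computable_conjBall {r : List A × List A → Bool} (hr : Computable r) :
    Computable₂ (conjBall r) :=
  Computable.nat_rec (f := fun p : List A × ℕ => p.2) (g := fun p => [p.1])
    (h := fun p (q : ℕ × List (List A)) => conjNeighbours r p.1.length q.2) Computable.snd
    (Computable.list_cons.comp Computable.fst (Computable.const []))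
    ((computable_conjNeighbours hr).comp
      (Computable.list_length.comp (Computable.fst.comp Computable.fst))
      (Computable.snd.comp Computable.snd)).to₂

variable {rels : FreeMonoid A → FreeMonoid A → Prop} {r : List A × List A → Bool}

theorem mem_conjNeighbours
    (hr : ∀ p, rels (FreeMonoid.ofList p.1) (FreeMonoid.ofList p.2) ↔ r p = true)
    {n : ℕ} {W : List (List A)} {w' : List A} :
    w' ∈ conjNeighbours r n W ↔ w'.length = n ∧
      ∃ w ∈ W, w = w' ∨ ConjStep rels w w' ∨ ConjStep rels w' w := by
  simp [conjNeighbours, mem_wordsOfLength, conjStepBool_iff hr]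

theorem eqvGen_of_mem_conjBall
    (hr : ∀ p, rels (FreeMonoid.ofList p.1) (FreeMonoid.ofList p.2) ↔ r p = true)
    {u w : List A} {k : ℕ} (h : w ∈ conjBall r u k) :
    Relation.EqvGen (ConjStep rels) u w := by
  induction k generalizing w with
  | zero => rw [List.mem_singleton.1 h]; exact .refl _
  | succ k ih =>
    obtain ⟨-, x, hx, rfl | hs | hs⟩ := (mem_conjNeighbours hr).1 h
    · exact ih hx
    · exact .trans _ _ _ (ih hx) (.rel _ _ hs)
    · exact .trans _ _ _ (ih hx) (.symm _ _ (.rel _ _ hs))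

theorem conjBall_subset_succ (hR : IsHomogeneousPresentation rels)
    (hr : ∀ p, rels (FreeMonoid.ofList p.1) (FreeMonoid.ofList p.2) ↔ r p = true)
    (u : List A) (k : ℕ) : conjBall r u k ⊆ conjBall r u (k + 1) := fun w hw =>
  (mem_conjNeighbours hr).2 ⟨(eqvGen_conjStep_length_eq hR (eqvGen_of_mem_conjBall hr hw)).symm,
    w, hw, Or.inl rfl⟩

theorem mem_conjBall_self (hR : IsHomogeneousPresentation rels)
    (hr : ∀ p, rels (FreeMonoid.ofList p.1) (FreeMonoid.ofList p.2) ↔ r p = true)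
    (u : List A) (k : ℕ) : u ∈ conjBall r u k := by
  induction k with
  | zero => exact List.mem_singleton.2 rfl
  | succ k ih => exact conjBall_subset_succ hR hr u k ih

/-- A ball equal to its successor is closed under elementary steps in both directions, and it
contains its centre. -/
theorem mem_conjBall_iff_of_stable (hR : IsHomogeneousPresentation rels)
    (hr : ∀ p, rels (FreeMonoid.ofList p.1) (FreeMonoid.ofList p.2) ↔ r p = true)
    {u v : List A} {k : ℕ} (hk : conjBall r u k = conjBall r u (k + 1)) :
    v ∈ conjBall r u k ↔ Relation.EqvGen (ConjStep rels) u v := by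
  refine ⟨eqvGen_of_mem_conjBall hr, fun h => ?_⟩
  have hlen : ∀ {w}, w ∈ conjBall r u k → w.length = u.length := fun hw =>
    (eqvGen_conjStep_length_eq hR (eqvGen_of_mem_conjBall hr hw)).symm
  have key : ∀ a b, Relation.EqvGen (ConjStep rels) a b →
      (a ∈ conjBall r u k ↔ b ∈ conjBall r u k) := by
    intro a b hab
    induction hab with
    | rel a b h =>
      constructor <;> intro hm
      · rw [hk]
        exact (mem_conjNeighbours hr).2
          ⟨(h.length_eq hR).symm.trans (hlen hm), a, hm, Or.inr (Or.inl h)⟩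
      · rw [hk]
        exact (mem_conjNeighbours hr).2
          ⟨(h.length_eq hR).trans (hlen hm), b, hm, Or.inr (Or.inr h)⟩
    | refl _ => exact Iff.rfl
    | symm _ _ _ ih => exact ih.symm
    | trans _ _ _ _ _ ih₁ ih₂ => exact ih₁.trans ih₂
  exact (key u v h).1 (mem_conjBall_self hR hr u k)

/-- Increasing subsets of the finite set of words of length `|u|` become stationary. The test
compares lists rather than sets, but each later ball filters one fixed list by a condition depending
only on which words the previous ball contains. Hence agreement as sets at `k` gives equality of
lists one stage later. -/
theorem exists_conjBall_stable (hR : IsHomogeneousPresentation rels)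
    (hr : ∀ p, rels (FreeMonoid.ofList p.1) (FreeMonoid.ofList p.2) ↔ r p = true)
    (u : List A) : ∃ k, conjBall r u k = conjBall r u (k + 1) := by
  let balls : ℕ →o Set (List.Vector A u.length) :=
    ⟨fun k => {w | w.1 ∈ conjBall r u k}, monotone_nat_of_le_succ fun k w hw =>
      conjBall_subset_succ hR hr u k hw⟩
  obtain ⟨k, hk⟩ := WellFoundedGT.monotone_chain_condition balls
  refine ⟨k + 1, ?_⟩
  have hmem : ∀ w, w ∈ conjBall r u k ↔ w ∈ conjBall r u (k + 1) := by
    refine fun w => ⟨fun h => conjBall_subset_succ hR hr u k h, fun h => ?_⟩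
    have hw : w.length = u.length :=
      (eqvGen_conjStep_length_eq hR (eqvGen_of_mem_conjBall hr h)).symm
    have h' : (⟨w, hw⟩ : List.Vector A u.length) ∈ balls (k + 1) := h
    rw [← hk (k + 1) (Nat.le_succ k)] at h'
    exact h'
  refine List.filter_congr fun w _ => ?_
  rw [Bool.eq_iff_iff, List.any_eq_true, List.any_eq_true]
  exact exists_congr fun x => and_congr_left fun _ => hmem x

end Decision

theorem primaryConjStarDecidable_of_homogeneous {A : Type} [Finite A] [Primcodable A]
    {rels : FreeMonoid A → FreeMonoid A → Prop} (hR : IsHomogeneousPresentation rels)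
    (hdec : HasDecidableRelations rels) : PrimaryConjStarDecidable rels := by
  let _ := Encodable.decidableEqOfEncodable A
  obtain ⟨r, hrc, hre⟩ := ComputablePred.computable_iff.1 hdec
  have hr : ∀ p : List A × List A,
      rels (FreeMonoid.ofList p.1) (FreeMonoid.ofList p.2) ↔ r p = true :=
    fun p => iff_of_eq (congrFun hre p)
  have hball := computable_conjBall hrc
  have hstable : ComputablePred fun p : List A × ℕ =>
      conjBall r p.1 p.2 = conjBall r p.1 (p.2 + 1) := by
    refine ⟨inferInstance, ?_⟩
    exact (Primrec.eq.decide.to_comp).comp (hball.comp Computable.fst Computable.snd)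
      (hball.comp Computable.fst (Computable.succ.comp Computable.snd))
  -- The unbounded search for a stable stage is total because such a stage always exists.
  have hfind := Computable.find (P := fun u k => conjBall r u k = conjBall r u (k + 1)) hstable
    (exists_conjBall_stable hR hr)
  refine ComputablePred.computable_iff.2 ⟨fun p =>
    (conjBall r p.1 (Nat.find (exists_conjBall_stable hR hr p.1))).any fun w =>
      decide (w = p.2), ?_, ?_⟩
  · refine Computable.list_any (hball.comp Computable.fst (hfind.comp Computable.fst)) ?_
    exact (Primrec.eq.comp Primrec.snd (Primrec.snd.comp Primrec.fst)).decide.to_comp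
  · funext p
    refine propext ((primaryConjStar_iff_eqvGen_conjStep hR).trans ?_)
    rw [← mem_conjBall_iff_of_stable hR hr (Nat.find_spec (exists_conjBall_stable hR hr p.1))]
    simp

/-! ### Simulating a Turing machine by a finite presentation -/

open Turing

/-- Letters of the words that describe the configurations of a Turing machine. -/
inductive TapeLetter (Γ Λ : Type) : Type
  | left (a : Γ)
  | right (a : Γ)
  | state (q : Λ)
  | halt
  | leftEnd
  | rightEnd

namespace TapeLetter

variable {Γ Λ : Type}

/-- A Turing machine letter as an element of a sum of types. -/
def toSum : TapeLetter Γ Λ → (Γ ⊕ Γ) ⊕ (Λ ⊕ Fin 3)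
  | left a => .inl (.inl a)
  | right a => .inl (.inr a)
  | state q => .inr (.inl q)
  | halt => .inr (.inr 0)
  | leftEnd => .inr (.inr 1)
  | rightEnd => .inr (.inr 2)

theorem toSum_injective : Function.Injective (toSum : TapeLetter Γ Λ → _) := by
  intro x y h
  cases x <;> cases y <;> simp_all [toSum]

instance [Finite Γ] [Finite Λ] : Finite (TapeLetter Γ Λ) :=
  Finite.of_injective _ toSum_injective

end TapeLetter

open TapeLetter

section

variable {Γ Λ : Type} [Inhabited Γ] [Inhabited Λ]

/-- The defining relations that simulate a Turing machine: `left` and `right` letters are the tape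
letters on the two sides of the head, the state letter stands in front of the scanned letter. -/
inductive MachineRel (M : TM0.Machine Γ Λ) :
    FreeMonoid (TapeLetter Γ Λ) → FreeMonoid (TapeLetter Γ Λ) → Prop
  | moveRight {q a q'} (h : M q a = some (q', .move .right)) :
      MachineRel M (.of (state q) * .of (right a)) (.of (left a) * .of (state q'))
  | moveLeft {q a q'} (c : Γ) (h : M q a = some (q', .move .left)) :
      MachineRel M (.of (left c) * .of (state q) * .of (right a))
        (.of (state q') * .of (right c) * .of (right a))
  | write {q a q' b} (h : M q a = some (q', .write b)) :
      MachineRel M (.of (state q) * .of (right a)) (.of (state q') * .of (right b))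
  | halted {q a} (h : M q a = none) :
      MachineRel M (.of (state q) * .of (right a)) (.of halt * .of (right a))
  | eraseRight (a : Γ) : MachineRel M (.of halt * .of (right a)) (.of halt)
  | eraseLeft (a : Γ) : MachineRel M (.of (left a) * .of halt) (.of halt)
  | extendRight : MachineRel M (.of rightEnd) (.of (right default) * .of rightEnd)
  | extendLeft : MachineRel M (.of leftEnd) (.of leftEnd * .of (left default))

/-- The values on which the simulating monoid acts: a right half tape, the set of the left half
tapes from which the machine halts, or a truth value. -/
inductive HaltingValue (Γ : Type) [Inhabited Γ] : Type
  | tape (R : ListBlank Γ)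
  | conf (P : ListBlank Γ → Prop)
  | final (p : Prop)

/-- The machine halts from state `q` on the tape with left half `L` and right half `R`. -/
def HaltsFrom (M : TM0.Machine Γ Λ) (q : Λ) (L R : ListBlank Γ) : Prop :=
  (StateTransition.eval (TM0.step M) ⟨q, Tape.mk' L R⟩).Dom

theorem haltsFrom_iff_of_step {M : TM0.Machine Γ Λ} {q q' : Λ} {L R L' R' : ListBlank Γ}
    (h : TM0.step M ⟨q, Tape.mk' L R⟩ = some ⟨q', Tape.mk' L' R'⟩) :
    HaltsFrom M q L R ↔ HaltsFrom M q' L' R' := by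
  unfold HaltsFrom
  rw [StateTransition.reaches_eval (Relation.ReflTransGen.single h)]

theorem haltsFrom_of_step_eq_none {M : TM0.Machine Γ Λ} {q : Λ} {L R : ListBlank Γ}
    (h : TM0.step M ⟨q, Tape.mk' L R⟩ = none) : HaltsFrom M q L R :=
  Part.dom_iff_mem.2 ⟨_, StateTransition.mem_eval.2 ⟨.refl, h⟩⟩

theorem step_moveRight {M : TM0.Machine Γ Λ} {q q' : Λ} {a : Γ} {L R : ListBlank Γ}
    (h : M q a = some (q', .move .right)) :
    TM0.step M ⟨q, Tape.mk' L (R.cons a)⟩ = some ⟨q', Tape.mk' (L.cons a) R⟩ := by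
  simp [TM0.step, h]

theorem step_moveLeft {M : TM0.Machine Γ Λ} {q q' : Λ} {a c : Γ} {L R : ListBlank Γ}
    (h : M q a = some (q', .move .left)) :
    TM0.step M ⟨q, Tape.mk' (L.cons c) (R.cons a)⟩ =
      some ⟨q', Tape.mk' L ((R.cons a).cons c)⟩ := by
  simp [TM0.step, h]

theorem step_write {M : TM0.Machine Γ Λ} {q q' : Λ} {a b : Γ} {L R : ListBlank Γ}
    (h : M q a = some (q', .write b)) :
    TM0.step M ⟨q, Tape.mk' L (R.cons a)⟩ = some ⟨q', Tape.mk' L (R.cons b)⟩ := by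
  simp [TM0.step, h]

theorem step_eq_none {M : TM0.Machine Γ Λ} {q : Λ} {a : Γ} {L R : ListBlank Γ}
    (h : M q a = none) : TM0.step M ⟨q, Tape.mk' L (R.cons a)⟩ = none := by
  simp [TM0.step, h]

open HaltingValue in
/-- The action of the letters on halting values. -/
def letterAction (M : TM0.Machine Γ Λ) :
    TapeLetter Γ Λ → Function.End (HaltingValue Γ)
  | left a => fun x => match x with
    | conf P => conf fun L => P (L.cons a)
    | _ => final False
  | right a => fun x => match x with
    | tape R => tape (R.cons a)
    | _ => final False
  | state q => fun x => match x with
    | tape R => conf fun L => HaltsFrom M q L R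
    | _ => final False
  | halt => fun x => match x with
    | tape _ => conf fun _ => True
    | _ => final False
  | leftEnd => fun x => match x with
    | conf P => final (P default)
    | _ => final False
  | rightEnd => fun _ => tape default

theorem ListBlank.cons_default_default : (default : ListBlank Γ).cons default = default :=
  ListBlank.cons_head_tail (default : ListBlank Γ)

/-- Reading a configuration word from the right builds the right half tape, then the predicate
"halts with this left half tape", then its value at the actual tape. A machine step does not change
whether the machine halts, so machine relations act trivially; `halt` acts as the constantly true
predicate, which absorbs tape letters. Ill-formed words fall into `final False` on both sides. -/
theorem letterAction_respects (M : TM0.Machine Γ Λ) (u v : FreeMonoid (TapeLetter Γ Λ))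
    (h : MachineRel M u v) :
    FreeMonoid.lift (letterAction M) u = FreeMonoid.lift (letterAction M) v := by
  funext x
  cases h <;> simp only [map_mul, FreeMonoid.lift_eval_of, Function.End.mul_apply]
  case moveRight h =>
    cases x <;> simp [letterAction, haltsFrom_iff_of_step (step_moveRight h)]
  case moveLeft h =>
    cases x <;> simp [letterAction, haltsFrom_iff_of_step (step_moveLeft h)]
  case write h =>
    cases x <;> simp [letterAction, haltsFrom_iff_of_step (step_write h)]
  case halted h =>
    cases x <;> simp [letterAction, haltsFrom_of_step_eq_none (step_eq_none h)]
  case eraseRight a => cases x <;> simp [letterAction]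
  case eraseLeft a => cases x <;> simp [letterAction]
  case extendRight => simp [letterAction, ListBlank.cons_default_default]
  case extendLeft => cases x <;> simp [letterAction, ListBlank.cons_default_default]

/-- The word that describes the configuration with state `q`, left half tape `l` (read from the
head outwards) and right half tape `r`. -/
def configWord (l : List Γ) (q : Λ) (r : List Γ) : List (TapeLetter Γ Λ) :=
  leftEnd :: (l.reverse.map left ++ state q :: (r.map right ++ [rightEnd]))

/-- The word of a halted configuration. -/
def haltWord : List (TapeLetter Γ Λ) := [leftEnd, halt, rightEnd]

theorem lift_map_right (M : TM0.Machine Γ Λ) (r : List Γ) :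
    FreeMonoid.lift (letterAction M) (.ofList (r.map right)) (.tape default) =
      .tape (ListBlank.mk r) := by
  induction r with
  | nil => rfl
  | cons a r ih =>
    rw [List.map_cons, FreeMonoid.ofList_cons, map_mul, FreeMonoid.lift_eval_of,
      Function.End.mul_apply, ih]
    simp [letterAction]

theorem lift_map_left (M : TM0.Machine Γ Λ) (l : List Γ) (P : ListBlank Γ → Prop) :
    FreeMonoid.lift (letterAction M) (.ofList (l.reverse.map left)) (.conf P) =
      .conf fun L => P (ListBlank.append l L) := by
  induction l generalizing P with
  | nil => rfl
  | cons a l ih =>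
    rw [List.reverse_cons, List.map_append, FreeMonoid.ofList_append, map_mul,
      List.map_singleton, FreeMonoid.ofList_singleton, FreeMonoid.lift_eval_of,
      Function.End.mul_apply]
    exact ih _

theorem lift_configWord (M : TM0.Machine Γ Λ) (l : List Γ) (q : Λ) (r : List Γ)
    (x : HaltingValue Γ) :
    FreeMonoid.lift (letterAction M) (.ofList (configWord l q r)) x =
      .final (HaltsFrom M q (ListBlank.mk l) (ListBlank.mk r)) := by
  simp only [configWord, FreeMonoid.ofList_cons, FreeMonoid.ofList_append, map_mul,
    Function.End.mul_apply, FreeMonoid.lift_eval_of, FreeMonoid.ofList_nil, map_one]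
  change letterAction M leftEnd (FreeMonoid.lift (letterAction M) _
    (letterAction M (state q) (FreeMonoid.lift (letterAction M) _ (.tape default)))) = _
  rw [lift_map_right]
  change letterAction M leftEnd (FreeMonoid.lift (letterAction M) _
    (.conf fun L => HaltsFrom M q L (ListBlank.mk r))) = _
  rw [lift_map_left]
  change HaltingValue.final (HaltsFrom M q (ListBlank.append l (ListBlank.mk [])) _) = _
  rw [ListBlank.append_mk, List.append_nil]

theorem wordElt_configWord_left_nil (M : TM0.Machine Γ Λ) (q : Λ) (r : List Γ) :
    wordElt (MachineRel M) (configWord [] q r) =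
      wordElt (MachineRel M) (configWord [default] q r) :=
  wordElt_eq_of_rel (u := [leftEnd]) (v := [leftEnd, left default]) (.extendLeft) []
    (state q :: (r.map right ++ [rightEnd]))

theorem wordElt_configWord_right_nil (M : TM0.Machine Γ Λ) (l : List Γ) (q : Λ) :
    wordElt (MachineRel M) (configWord l q []) =
      wordElt (MachineRel M) (configWord l q [default]) := by
  have h := wordElt_eq_of_rel (u := [rightEnd]) (v := [right default, rightEnd])
    (MachineRel.extendRight (M := M)) (leftEnd :: (l.reverse.map left ++ [state q])) []
  simp only [List.append_nil, List.cons_append, List.append_assoc, List.nil_append] at h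
  exact h

theorem wordElt_configWord_moveRight {M : TM0.Machine Γ Λ} {q q' : Λ} {a : Γ}
    (h : M q a = some (q', .move .right)) (l r : List Γ) :
    wordElt (MachineRel M) (configWord l q (a :: r)) =
      wordElt (MachineRel M) (configWord (a :: l) q' r) := by
  simpa [configWord] using
    wordElt_eq_of_rel (u := [state q, right a]) (v := [left a, state q'])
      (MachineRel.moveRight h) (leftEnd :: l.reverse.map left) (r.map right ++ [rightEnd])

theorem wordElt_configWord_moveLeft {M : TM0.Machine Γ Λ} {q q' : Λ} {a : Γ}
    (h : M q a = some (q', .move .left)) (c : Γ) (l r : List Γ) :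
    wordElt (MachineRel M) (configWord (c :: l) q (a :: r)) =
      wordElt (MachineRel M) (configWord l q' (c :: a :: r)) := by
  simpa [configWord] using
    wordElt_eq_of_rel (u := [left c, state q, right a]) (v := [state q', right c, right a])
      (MachineRel.moveLeft c h) (leftEnd :: l.reverse.map left) (r.map right ++ [rightEnd])

theorem wordElt_configWord_write {M : TM0.Machine Γ Λ} {q q' : Λ} {a b : Γ}
    (h : M q a = some (q', .write b)) (l r : List Γ) :
    wordElt (MachineRel M) (configWord l q (a :: r)) =
      wordElt (MachineRel M) (configWord l q' (b :: r)) := by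
  simpa [configWord] using
    wordElt_eq_of_rel (u := [state q, right a]) (v := [state q', right b])
      (MachineRel.write h) (leftEnd :: l.reverse.map left) (r.map right ++ [rightEnd])

theorem wordElt_halt_eraseRight (M : TM0.Machine Γ Λ) (p : List (TapeLetter Γ Λ)) (r : List Γ)
    (s : List (TapeLetter Γ Λ)) :
    wordElt (MachineRel M) (p ++ halt :: (r.map right ++ s)) =
      wordElt (MachineRel M) (p ++ halt :: s) := by
  induction r with
  | nil => rfl
  | cons a r ih =>
    exact (wordElt_eq_of_rel (u := [halt, right a]) (v := [halt]) (.eraseRight a) p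
      (r.map right ++ s)).trans ih

theorem wordElt_halt_eraseLeft (M : TM0.Machine Γ Λ) (p : List (TapeLetter Γ Λ)) (l : List Γ)
    (s : List (TapeLetter Γ Λ)) :
    wordElt (MachineRel M) (p ++ (l.reverse.map left ++ halt :: s)) =
      wordElt (MachineRel M) (p ++ halt :: s) := by
  induction l with
  | nil => rfl
  | cons a l ih =>
    have := wordElt_eq_of_rel (u := [left a, halt]) (v := [halt])
      (MachineRel.eraseLeft (M := M) a) (p ++ l.reverse.map left) s
    simp only [List.append_assoc, List.cons_append, List.nil_append] at this
    rw [← ih, ← this]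
    simp

theorem wordElt_configWord_halted {M : TM0.Machine Γ Λ} {q : Λ} {a : Γ}
    (h : M q a = none) (l r : List Γ) :
    wordElt (MachineRel M) (configWord l q (a :: r)) = wordElt (MachineRel M) haltWord := by
  have h1 : wordElt (MachineRel M) (configWord l q (a :: r)) =
      wordElt (MachineRel M)
        (leftEnd :: l.reverse.map left ++ halt :: ((a :: r).map right ++ [rightEnd])) := by
    simpa [configWord] using
      wordElt_eq_of_rel (u := [state q, right a]) (v := [halt, right a])
        (MachineRel.halted h) (leftEnd :: l.reverse.map left) (r.map right ++ [rightEnd])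
  rw [h1, wordElt_halt_eraseRight]
  exact wordElt_halt_eraseLeft M [leftEnd] l [rightEnd]

/-- Induction along the halting run, for all lists `l`, `r` representing the tape. The lists may end
where the machine needs a cell; the end-marker relations then supply a blank without changing the
element. Once halted, `halt` erases both half tapes. -/
theorem wordElt_configWord_of_haltsFrom {M : TM0.Machine Γ Λ} {c c' : TM0.Cfg Γ Λ}
    (hc : StateTransition.Reaches (TM0.step M) c c') (hc' : TM0.step M c' = none) (l : List Γ)
    (q : Λ) (r : List Γ) (h : c = ⟨q, Tape.mk' (ListBlank.mk l) (ListBlank.mk r)⟩) :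
    wordElt (MachineRel M) (configWord l q r) = wordElt (MachineRel M) haltWord := by
  have hright : ∀ r : List Γ, ∃ a r', ListBlank.mk r = ListBlank.mk (a :: r') ∧ ∀ l q,
      wordElt (MachineRel M) (configWord l q r) =
        wordElt (MachineRel M) (configWord l q (a :: r')) := by
    rintro (_ | ⟨a, r⟩)
    · exact ⟨default, [], ListBlank.cons_default_default.symm,
        fun l q => wordElt_configWord_right_nil M l q⟩
    · exact ⟨a, r, rfl, fun _ _ => rfl⟩
  have hleft : ∀ l : List Γ, ∃ a l', ListBlank.mk l = ListBlank.mk (a :: l') ∧ ∀ q r,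
      wordElt (MachineRel M) (configWord l q r) =
        wordElt (MachineRel M) (configWord (a :: l') q r) := by
    rintro (_ | ⟨a, r⟩)
    · exact ⟨default, [], ListBlank.cons_default_default.symm,
        fun q r => wordElt_configWord_left_nil M q r⟩
    · exact ⟨a, r, rfl, fun _ _ => rfl⟩
  induction hc using Relation.ReflTransGen.head_induction_on generalizing l q r with
  | refl =>
    obtain ⟨a, r', hr, hr'⟩ := hright r
    rw [hr']
    rw [hr] at h
    subst h
    refine wordElt_configWord_halted ?_ l r'
    simpa [TM0.step] using hc'
  | head hab _ ih =>
    obtain ⟨a, r', hr, hr'⟩ := hright r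
    rw [hr']
    rw [hr] at h
    subst h
    rcases hM : M q a with _ | ⟨q', (_ | _) | b⟩
    · simp [TM0.step, hM] at hab
    · obtain ⟨b, l', hl, hl'⟩ := hleft l
      rw [hl', wordElt_configWord_moveLeft hM]
      rw [hl, ← ListBlank.cons_mk, ← ListBlank.cons_mk, Option.mem_def, step_moveLeft hM] at hab
      exact ih _ _ _ (Option.some.inj hab).symm
    · rw [wordElt_configWord_moveRight hM]
      rw [← ListBlank.cons_mk, Option.mem_def, step_moveRight hM] at hab
      exact ih _ _ _ (Option.some.inj hab).symm
    · rw [wordElt_configWord_write hM]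
      rw [← ListBlank.cons_mk, Option.mem_def, step_write hM] at hab
      exact ih _ _ _ (Option.some.inj hab).symm

/-- The simulating monoid identifies the word of an initial configuration with the halting word
exactly when the machine halts on that input. -/
theorem wordElt_configWord_eq_haltWord_iff (M : TM0.Machine Γ Λ) (input : List Γ) :
    wordElt (MachineRel M) (configWord [] default input) = wordElt (MachineRel M) haltWord ↔
      (TM0.eval M input).Dom := by
  have hdom : (TM0.eval M input).Dom ↔
      HaltsFrom M default (ListBlank.mk []) (ListBlank.mk input) := Iff.rfl
  rw [hdom]
  constructor
  · intro h
    -- The starting value is immaterial, since `rightEnd` discards it.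
    have h' := congrArg
      (fun z => PresentedMonoid.lift (letterAction M) (letterAction_respects M) z (.final True)) h
    have h'' : HaltingValue.final (HaltsFrom M default (ListBlank.mk []) (ListBlank.mk input)) =
        HaltingValue.final True := (lift_configWord M [] default input _).symm.trans h'
    simpa using h''
  · intro h
    obtain ⟨c', hc'⟩ := Part.dom_iff_mem.1 h
    obtain ⟨h₁, h₂⟩ := StateTransition.mem_eval.1 hc'
    exact wordElt_configWord_of_haltsFrom h₁ h₂ _ _ _ rfl

theorem machineRel_finite [Finite Γ] [Finite Λ] (M : TM0.Machine Γ Λ) :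
    {p : FreeMonoid (TapeLetter Γ Λ) × FreeMonoid (TapeLetter Γ Λ) |
      MachineRel M p.1 p.2}.Finite := by
  -- No side of a machine relation has more than three letters.
  have hlen : {p : List (TapeLetter Γ Λ) × List (TapeLetter Γ Λ) |
      p.1.length ≤ 3 ∧ p.2.length ≤ 3}.Finite :=
    ((List.finite_length_le _ 3).prod (List.finite_length_le _ 3))
  refine hlen.subset ?_
  rintro ⟨u, v⟩ h
  cases h <;> exact ⟨Nat.le_of_ble_eq_true rfl, Nat.le_of_ble_eq_true rfl⟩

end

/-! ### Padding to a homogeneous presentation, and the bar letter -/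

/-- The letters of an alphabet together with a padding letter and a bar. -/
inductive PaddedLetter (α : Type) : Type
  | letter (a : α)
  | pad
  | bar

namespace PaddedLetter

variable {α : Type}

instance [Finite α] : Finite (PaddedLetter α) :=
  Finite.of_injective
    (fun x : PaddedLetter α => match x with
      | letter a => some (some a)
      | pad => some none
      | bar => none) <| by
    intro x y h
    cases x <;> cases y <;> simp_all

end PaddedLetter

open PaddedLetter

section

variable {α : Type} (S : FreeMonoid α → FreeMonoid α → Prop)

/-- The homogeneous relations obtained from given ones by filling up with a central padding letter,
over an alphabet with a further free letter, the bar. -/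
inductive PaddedRel : FreeMonoid (PaddedLetter α) → FreeMonoid (PaddedLetter α) → Prop
  | comm (c : PaddedLetter α) : PaddedRel (.ofList [pad, c]) (.ofList [c, pad])
  | rel {u v : List α} (h : S (.ofList u) (.ofList v)) :
      PaddedRel (.ofList (u.map letter ++ List.replicate v.length pad))
        (.ofList (v.map letter ++ List.replicate u.length pad))

/-- Each side carries as many padding letters as the other side has letters, so both have length
`|u| + |v|`. -/
theorem paddedRel_homogeneous : IsHomogeneousPresentation (PaddedRel S) := by
  intro u v h
  cases h with
  | comm c => rfl
  | @rel u v h =>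
    change (u.map letter ++ List.replicate v.length pad).length =
      (v.map letter ++ List.replicate u.length pad).length
    simp [add_comm]

theorem paddedRel_finite [Finite α]
    (hS : {p : FreeMonoid α × FreeMonoid α | S p.1 p.2}.Finite) :
    {p : FreeMonoid (PaddedLetter α) × FreeMonoid (PaddedLetter α) |
      PaddedRel S p.1 p.2}.Finite := by
  refine ((Set.finite_range fun c : PaddedLetter α =>
    (FreeMonoid.ofList [pad, c], FreeMonoid.ofList [c, pad])).union
    (hS.image fun p => (FreeMonoid.ofList (p.1.toList.map letter ++
      List.replicate p.2.toList.length pad), FreeMonoid.ofList (p.2.toList.map letter ++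
      List.replicate p.1.toList.length pad)))).subset ?_
  rintro ⟨u, v⟩ h
  cases h with
  | comm c => exact Or.inl ⟨c, rfl⟩
  | @rel u v h => exact Or.inr ⟨(.ofList u, .ofList v), h, rfl⟩

/-- The class of the padding letter. -/
def padElt : PresentedMonoid (PaddedRel S) := wordElt (PaddedRel S) [pad]

/-- The class of a word over the original alphabet. -/
def letterElt (u : List α) : PresentedMonoid (PaddedRel S) :=
  wordElt (PaddedRel S) (u.map letter)

theorem wordElt_replicate_pad (n : ℕ) :
    wordElt (PaddedRel S) (List.replicate n pad) = padElt S ^ n := by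
  induction n with
  | zero => rfl
  | succ n ih =>
    rw [List.replicate_succ, pow_succ', ← ih]
    exact wordElt_append _ [pad] _

theorem padElt_commute (z : PresentedMonoid (PaddedRel S)) : Commute (padElt S) z := by
  obtain ⟨w, rfl⟩ := PresentedMonoid.surjective_mk z
  induction w with
  | one => exact Commute.one_right _
  | of c => exact PresentedMonoid.mk_eq_mk_of_rel (PaddedRel.comm c)
  | mul u v hu hv => rw [map_mul]; exact hu.mul_right hv

theorem padElt_pow_mul (n : ℕ) (z : PresentedMonoid (PaddedRel S)) :
    padElt S ^ n * z = z * padElt S ^ n :=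
  ((padElt_commute S z).pow_left n).eq

theorem letterElt_append (u v : List α) :
    letterElt S (u ++ v) = letterElt S u * letterElt S v := by
  simp [letterElt, wordElt_append]

/-- Words that become equal after padding. -/
def padCon : Con (FreeMonoid α) where
  r u v := ∃ i j, u.toList.length + i = v.toList.length + j ∧
    letterElt S u.toList * padElt S ^ i = letterElt S v.toList * padElt S ^ j
  iseqv :=
    { refl := fun u => ⟨0, 0, rfl, rfl⟩
      symm := fun ⟨i, j, h, e⟩ => ⟨j, i, h.symm, e.symm⟩
      trans := by
        rintro u v w ⟨i, j, h, e⟩ ⟨i', j', h', e'⟩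
        refine ⟨i + i', j' + j, by omega, ?_⟩
        rw [pow_add, ← mul_assoc, e, mul_assoc, ← pow_add, add_comm j, pow_add, ← mul_assoc, e',
          mul_assoc, ← pow_add] }
  mul' := by
    rintro u u' v v' ⟨i, j, h, e⟩ ⟨i', j', h', e'⟩
    refine ⟨i + i', j + j', by simp only [FreeMonoid.toList_mul, List.length_append]; omega, ?_⟩
    have key : ∀ (x y : List α) (m n : ℕ),
        letterElt S (x ++ y) * padElt S ^ (m + n) =
          (letterElt S x * padElt S ^ m) * (letterElt S y * padElt S ^ n) := by
      intro x y m n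
      rw [letterElt_append, pow_add, mul_assoc, mul_assoc, ← mul_assoc (letterElt S y),
        ← mul_assoc (padElt S ^ m), padElt_pow_mul]
    rw [FreeMonoid.toList_mul, FreeMonoid.toList_mul, key, key, e, e']

/-- Centrality of `pad` makes equality after padding a congruence, and it contains `S` by
construction of the padded relations. The length equation is carried along to fix the difference of
the exponents. -/
theorem exists_padding_of_wordElt_eq {u v : List α} (h : wordElt S u = wordElt S v) :
    ∃ i j, u.length + i = v.length + j ∧
      letterElt S u * padElt S ^ i = letterElt S v * padElt S ^ j := by
  have hle : conGen S ≤ padCon S := by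
    refine Con.conGen_le.2 fun x y hxy => ⟨y.toList.length, x.toList.length, add_comm _ _, ?_⟩
    have := PresentedMonoid.mk_eq_mk_of_rel (PaddedRel.rel (S := S) (u := x.toList)
      (v := y.toList) hxy)
    rw [← wordElt_replicate_pad, ← wordElt_replicate_pad, letterElt, letterElt,
      ← wordElt_append, ← wordElt_append]
    exact this
  exact hle (PresentedMonoid.mk_eq_mk_iff.1 h)

/-- The action of the letters on the sequences of bar-free factors of a word. -/
def factorAction : PaddedLetter α →
    Function.End (PresentedMonoid S × List (PresentedMonoid S))
  | letter a => fun x => (wordElt S [a] * x.1, x.2)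
  | pad => fun x => x
  | bar => fun x => (1, x.1 :: x.2)

theorem lift_factorAction_letters (u : List α)
    (x : PresentedMonoid S × List (PresentedMonoid S)) :
    FreeMonoid.lift (factorAction S) (.ofList (u.map letter)) x = (wordElt S u * x.1, x.2) := by
  induction u with
  | nil => exact Prod.ext (one_mul _).symm rfl
  | cons a u ih =>
    rw [List.map_cons, FreeMonoid.ofList_cons, map_mul]
    change factorAction S (letter a) (FreeMonoid.lift (factorAction S) _ x) = _
    rw [ih]
    change (wordElt S [a] * (wordElt S u * x.1), x.2) = _
    rw [← mul_assoc, ← wordElt_append]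
    rfl

theorem lift_factorAction_pad (n : ℕ) (x : PresentedMonoid S × List (PresentedMonoid S)) :
    FreeMonoid.lift (factorAction S) (.ofList (List.replicate n pad)) x = x := by
  induction n with
  | zero => rfl
  | succ n ih =>
    rw [List.replicate_succ, FreeMonoid.ofList_cons, map_mul]
    exact ih

theorem lift_factorAction_padded (u : List α) (n : ℕ)
    (x : PresentedMonoid S × List (PresentedMonoid S)) :
    FreeMonoid.lift (factorAction S) (.ofList (u.map letter ++ List.replicate n pad)) x =
      (wordElt S u * x.1, x.2) := by
  rw [FreeMonoid.ofList_append, map_mul]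
  change FreeMonoid.lift (factorAction S) _ (FreeMonoid.lift (factorAction S) _ x) = _
  rw [lift_factorAction_pad, lift_factorAction_letters]

theorem factorAction_respects (u v : FreeMonoid (PaddedLetter α)) (h : PaddedRel S u v) :
    FreeMonoid.lift (factorAction S) u = FreeMonoid.lift (factorAction S) v := by
  cases h with
  | comm c => rfl
  | rel h =>
    funext x
    rw [lift_factorAction_padded, lift_factorAction_padded,
      show wordElt S _ = wordElt S _ from PresentedMonoid.mk_eq_mk_of_rel h]

/-- The action of the padded monoid on sequences of factors. -/
def factorHom : PresentedMonoid (PaddedRel S) →*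
    Function.End (PresentedMonoid S × List (PresentedMonoid S)) :=
  PresentedMonoid.lift (factorAction S) (factorAction_respects S)

/-- Letters only push onto the list of closed factors and never inspect it, so a tail `t` passes
through untouched. -/
theorem factorHom_append (g : PresentedMonoid (PaddedRel S)) (k : PresentedMonoid S)
    (l t : List (PresentedMonoid S)) :
    factorHom S g (k, l ++ t) = ((factorHom S g (k, l)).1, (factorHom S g (k, l)).2 ++ t) := by
  obtain ⟨w, rfl⟩ := PresentedMonoid.surjective_mk g
  induction w generalizing k l with
  | one => rfl
  | of c => cases c <;> rfl
  | mul u v hu hv =>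
    rw [map_mul, map_mul]
    rw [Function.End.mul_apply, Function.End.mul_apply, hv, hu]

theorem List.eq_of_cons_eq_concat {β : Type*} {a b : β} {l : List β} (h : a :: l = l ++ [b]) :
    a = b := by
  induction l with
  | nil => simpa using h
  | cons c l ih =>
    rw [List.cons_append, List.cons.injEq] at h
    exact ih (h.1 ▸ h.2)

/-- The word `bar · u · padⁿ`. -/
def barWord (u : List α) (n : ℕ) : List (PaddedLetter α) :=
  bar :: (u.map letter ++ List.replicate n pad)

theorem factorHom_barWord (u : List α) (n : ℕ)
    (x : PresentedMonoid S × List (PresentedMonoid S)) :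
    factorHom S (wordElt (PaddedRel S) (barWord u n)) x = (1, (wordElt S u * x.1) :: x.2) := by
  change FreeMonoid.lift (factorAction S) (.ofList (barWord u n)) x = _
  rw [barWord, FreeMonoid.ofList_cons, map_mul]
  change factorAction S bar (FreeMonoid.lift (factorAction S) _ x) = _
  rw [lift_factorAction_padded]
  rfl

theorem wordElt_barWord (u : List α) (n : ℕ) :
    wordElt (PaddedRel S) (barWord u n) =
      wordElt (PaddedRel S) [bar] * (letterElt S u * padElt S ^ n) := by
  rw [letterElt, ← wordElt_replicate_pad, ← wordElt_append, ← wordElt_append]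
  rfl

/-- Forward, only `x g = g y` is needed: acting on `(1, [])`, the left side puts a factor in front
of the list produced by `g`, the right side appends `v` behind it, and comparing first components
makes the open factor left by `g` trivial. So `u :: l = l ++ [v]`, which forces `u = v`. Conversely,
equality in `⟨α | S⟩` becomes equality after multiplying by a power of the central `pad`, and that
power serves as both conjugators. -/
theorem oConj_barWord_iff {u v : List α} {m n : ℕ} (hlen : u.length + m = v.length + n) :
    OConj (wordElt (PaddedRel S) (barWord u m)) (wordElt (PaddedRel S) (barWord v n)) ↔
      wordElt S u = wordElt S v := by
  constructor
  · rintro ⟨g, -, hg, -⟩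
    have h := congrFun (congrArg (factorHom S) hg) (1, [])
    rw [map_mul, map_mul, Function.End.mul_apply, Function.End.mul_apply, factorHom_barWord, factorHom_barWord, mul_one] at h
    have happ := factorHom_append S g 1 [] [wordElt S v]
    rw [List.nil_append] at happ
    rw [happ, Prod.mk.injEq] at h
    rw [← h.1, mul_one] at h
    exact List.eq_of_cons_eq_concat h.2
  · intro h
    obtain ⟨i, j, hij, e⟩ := exists_padding_of_wordElt_eq S h
    -- Equal total lengths give `j + m = n + i`, so the same exponent `i` works on both sides.
    have key : wordElt (PaddedRel S) (barWord u m) * padElt S ^ i =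
        wordElt (PaddedRel S) (barWord v n) * padElt S ^ i := by
      rw [wordElt_barWord, wordElt_barWord, mul_assoc, mul_assoc, mul_assoc, mul_assoc,
        ← pow_add, ← pow_add, add_comm m, pow_add, ← mul_assoc (letterElt S u), e, mul_assoc,
        ← pow_add, show j + m = n + i by omega]
    refine ⟨padElt S ^ i, padElt S ^ i, ?_, ?_⟩
    · rw [key, padElt_pow_mul]
    · rw [← key, padElt_pow_mul]

end

/-! ### Renaming the alphabet -/

theorem OConj.map {M N : Type*} [Monoid M] [Monoid N] (f : M →* N) {x y : M} (h : OConj x y) :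
    OConj (f x) (f y) := by
  obtain ⟨g, k, hg, hk⟩ := h
  exact ⟨f g, f k, by rw [← map_mul, hg, map_mul], by rw [← map_mul, hk, map_mul]⟩

section Transport

variable {α β : Type} (e : α ≃ β) (rels : FreeMonoid α → FreeMonoid α → Prop)

/-- Defining relations transported along a bijection of alphabets. -/
def transportRel (u v : FreeMonoid β) : Prop :=
  rels (FreeMonoid.map e.symm u) (FreeMonoid.map e.symm v)

theorem length_freeMonoid_map {γ δ : Type} (f : γ → δ) (u : FreeMonoid γ) :
    (FreeMonoid.map f u).length = u.length :=
  List.length_map f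

theorem freeMonoid_map_map_of_leftInverse {γ δ : Type} {f : γ → δ} {g : δ → γ}
    (h : Function.LeftInverse g f) (u : FreeMonoid γ) :
    FreeMonoid.map g (FreeMonoid.map f u) = u := by
  apply FreeMonoid.toList.injective
  rw [FreeMonoid.toList_map, FreeMonoid.toList_map, List.map_map, h.comp_eq_id, List.map_id]

theorem transportRel_homogeneous (h : IsHomogeneousPresentation rels) :
    IsHomogeneousPresentation (transportRel e rels) := by
  intro u v huv
  have := h _ _ huv
  rwa [length_freeMonoid_map, length_freeMonoid_map] at this

theorem transportRel_finite (h : {p : FreeMonoid α × FreeMonoid α | rels p.1 p.2}.Finite) :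
    {p : FreeMonoid β × FreeMonoid β | transportRel e rels p.1 p.2}.Finite := by
  refine (h.image (Prod.map (FreeMonoid.map e) (FreeMonoid.map e))).subset ?_
  rintro ⟨u, v⟩ huv
  exact ⟨(FreeMonoid.map e.symm u, FreeMonoid.map e.symm v), huv, Prod.ext
    (freeMonoid_map_map_of_leftInverse e.right_inv u)
    (freeMonoid_map_map_of_leftInverse e.right_inv v)⟩

theorem lift_of_comp_eq {γ δ : Type} (f : γ → δ) (R : FreeMonoid δ → FreeMonoid δ → Prop)
    (u : FreeMonoid γ) :
    FreeMonoid.lift (fun a => PresentedMonoid.of R (f a)) u =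
      PresentedMonoid.mk R (FreeMonoid.map f u) := by
  induction u with
  | one => rfl
  | of a => rfl
  | mul u v hu hv => rw [map_mul, map_mul, map_mul, hu, hv]

theorem oConj_transport_iff (u v : List α) :
    OConj (wordElt (transportRel e rels) (u.map e)) (wordElt (transportRel e rels) (v.map e)) ↔
      OConj (wordElt rels u) (wordElt rels v) := by
  constructor
  · intro h
    have hrel : ∀ a b : FreeMonoid β, transportRel e rels a b →
        FreeMonoid.lift (fun b => PresentedMonoid.of rels (e.symm b)) a =
        FreeMonoid.lift (fun b => PresentedMonoid.of rels (e.symm b)) b := by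
      intro a b hab
      rw [lift_of_comp_eq, lift_of_comp_eq]
      exact PresentedMonoid.mk_eq_mk_of_rel hab
    have := h.map (PresentedMonoid.lift _ hrel)
    have key : ∀ w : List α, PresentedMonoid.lift _ hrel
        (wordElt (transportRel e rels) (w.map e)) = wordElt rels w := fun w =>
      (lift_of_comp_eq e.symm rels (FreeMonoid.map e (.ofList w))).trans
        (congrArg _ (freeMonoid_map_map_of_leftInverse e.left_inv _))
    rwa [key, key] at this
  · intro h
    have hrel : ∀ a b : FreeMonoid α, rels a b →
        FreeMonoid.lift (fun a => PresentedMonoid.of (transportRel e rels) (e a)) a =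
        FreeMonoid.lift (fun a => PresentedMonoid.of (transportRel e rels) (e a)) b := by
      intro a b hab
      rw [lift_of_comp_eq, lift_of_comp_eq]
      refine PresentedMonoid.mk_eq_mk_of_rel ?_
      rwa [transportRel, freeMonoid_map_map_of_leftInverse e.symm_apply_apply,
        freeMonoid_map_map_of_leftInverse e.symm_apply_apply]
    have := h.map (PresentedMonoid.lift _ hrel)
    have key : ∀ w : List α, PresentedMonoid.lift _ hrel (wordElt rels w) =
        wordElt (transportRel e rels) (w.map e) := fun w =>
      lift_of_comp_eq e (transportRel e rels) (.ofList w)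
    rwa [key, key] at this

end Transport

/-! ### Primitive recursive encoding of machine inputs -/

section

open PartrecToTM2

/-- The binary successor on digit lists, least significant digit first. -/
def digitSucc : List Γ' → List Γ'
  | [] => [Γ'.bit1]
  | Γ'.bit1 :: l => Γ'.bit0 :: digitSucc l
  | _ :: l => Γ'.bit1 :: l

theorem trPosNum_succ (n : PosNum) : trPosNum n.succ = digitSucc (trPosNum n) := by
  induction n with
  | one => rfl
  | bit0 n ih => rfl
  | bit1 n ih => simp [PosNum.succ, trPosNum, digitSucc, ih]

theorem trNat_succ (n : ℕ) : trNat (n + 1) = digitSucc (trNat n) := by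
  rw [trNat, trNat, Nat.cast_succ, Num.add_one]
  rcases (n : Num) with _ | p
  · rfl
  · exact trPosNum_succ p

theorem primrec_digitSucc [Primcodable Γ'] : Primrec digitSucc := by
  have h : Primrec fun l : List Γ' => (List.rec (motive := fun _ => List Γ') [Γ'.bit1]
      (fun a l ih => if a = Γ'.bit1 then Γ'.bit0 :: ih else Γ'.bit1 :: l) l : List Γ') := by
    refine Primrec.list_rec (h := fun (_ : List Γ') (p : Γ' × List Γ' × List Γ') =>
      if p.1 = Γ'.bit1 then Γ'.bit0 :: p.2.2 else Γ'.bit1 :: p.2.1) Primrec.id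
      (Primrec.const _) ?_
    exact (Primrec.ite (Primrec.eq.comp (Primrec.fst.comp Primrec.snd) (Primrec.const _))
      (Primrec.list_cons.comp (Primrec.const _) (Primrec.snd.comp (Primrec.snd.comp Primrec.snd)))
      (Primrec.list_cons.comp (Primrec.const _)
        (Primrec.fst.comp (Primrec.snd.comp Primrec.snd)))).to₂
  refine h.of_eq fun l => ?_
  induction l with
  | nil => rfl
  | cons a l ih => cases a <;> simp_all [digitSucc]

theorem primrec_trNat [Primcodable Γ'] : Primrec trNat := by
  refine (Primrec.nat_rec₁ [] (primrec_digitSucc.comp Primrec.snd).to₂).of_eq fun n => ?_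
  induction n with
  | zero => exact trNat_zero.symm
  | succ n ih => rw [trNat_succ, ← ih]

instance : Finite K' :=
  Finite.of_surjective (fun i : Fin 4 => ![K'.main, K'.rev, K'.aux, K'.stack] i) <| by
    rintro (_ | _ | _ | _)
    exacts [⟨0, rfl⟩, ⟨1, rfl⟩, ⟨2, rfl⟩, ⟨3, rfl⟩]

/-- A finite type has an encoding by natural numbers. -/
theorem exists_primcodable (α : Type*) [Finite α] : Nonempty (Primcodable α) :=
  let ⟨_, ⟨e⟩⟩ := Finite.exists_equiv_fin α
  ⟨Primcodable.ofEquiv _ e⟩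

/-- A tape cell of the multi-stack emulator that holds `a` on the stack `k` only. -/
def stackCell {K : Type} [DecidableEq K] {Γ : K → Type} (k : K) (a : Γ k) : TM2to1.Γ' K Γ :=
  (false, Function.update (fun _ => none) k (some a))

/-- A tape cell of the multi-stack emulator, marked as the bottom. -/
def markBottom {K : Type} {Γ : K → Type} (x : TM2to1.Γ' K Γ) : TM2to1.Γ' K Γ := (true, x.2)

theorem primrec_trInit {K : Type} [DecidableEq K] {Γ : K → Type} (k : K) [Primcodable (Γ k)]
    [Finite (Γ k)] [Primcodable (TM2to1.Γ' K Γ)] [Finite (TM2to1.Γ' K Γ)] :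
    Primrec fun L : List (Γ k) => TM2to1.trInit k L := by
  have h1 : Primrec fun L : List (Γ k) => L.reverse.map (stackCell k) :=
    Primrec.list_map Primrec.list_reverse
      ((Primrec.dom_finite (stackCell (Γ := Γ) k)).comp Primrec.snd).to₂
  have h2 : Primrec (markBottom (K := K) (Γ := Γ)) := Primrec.dom_finite _
  exact Primrec.list_cons.comp (h2.comp (Primrec.list_headI.comp h1)) (Primrec.list_tail.comp h1)

end

/-! ### A finite machine with undecidable halting problem -/

/-- The domain of the universal partial recursive function at input `0`. -/
theorem not_computablePred_halts_zero :
    ¬ ComputablePred fun n : ℕ => (Nat.Partrec.Code.eval (Denumerable.ofNat Nat.Partrec.Code n)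
      0).Dom := by
  intro h
  refine ComputablePred.halting_problem 0 ?_
  obtain ⟨f, hf, hfe⟩ := ComputablePred.computable_iff.1 h
  refine ComputablePred.computable_iff.2 ⟨fun c => f (Encodable.encode c),
    hf.comp Computable.encode, ?_⟩
  funext c
  have := congrFun hfe (Encodable.encode c)
  simpa using this

theorem exists_toPartrecCode_undecidable :
    ∃ c : ToPartrec.Code, ¬ ComputablePred fun n : ℕ => (c.eval [n]).Dom := by
  have hf : Partrec fun n : ℕ =>
      Nat.Partrec.Code.eval (Denumerable.ofNat Nat.Partrec.Code n) 0 :=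
    Nat.Partrec.Code.eval_part.comp (Computable.ofNat _) (Computable.const 0)
  obtain ⟨c, hc⟩ := ToPartrec.Code.exists_code (Nat.Partrec'.part_iff₁.2 hf)
  refine ⟨c, fun h => not_computablePred_halts_zero (h.of_eq fun n => ?_)⟩
  have := hc (n ::ᵥ List.Vector.nil)
  change c.eval [n] = _ at this
  rw [this]
  rfl

/-- There is a Turing machine with finitely many symbols and states whose halting problem is
undecidable. -/
theorem exists_machine_undecidable :
    ∃ (Γ Λ : Type) (_ : Inhabited Γ) (_ : Inhabited Λ) (_ : Finite Γ) (_ : Finite Λ)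
      (_ : Primcodable Γ) (M : TM0.Machine Γ Λ) (input : ℕ → List Γ), Primrec input ∧
      ¬ ComputablePred fun n => (TM0.eval M (input n)).Dom := by
  -- The code is compiled to a multi-stack machine and then to a single tape. The default state has
  -- to be the entry point of `c`, since runs begin there.
  obtain ⟨c, hc⟩ := exists_toPartrecCode_undecidable
  let start : Inhabited PartrecToTM2.Λ' := ⟨PartrecToTM2.trNormal c .halt⟩
  let Γ := TM2to1.Γ' PartrecToTM2.K' fun _ => PartrecToTM2.Γ'
  let M₁ := TM2to1.tr PartrecToTM2.tr
  let M₀ := TM1to0.tr M₁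
  have hfin : Finite Γ := inferInstanceAs
    (Finite (Bool × (PartrecToTM2.K' → Option PartrecToTM2.Γ')))
  obtain ⟨pΓ⟩ := exists_primcodable Γ
  obtain ⟨pΓ'⟩ := exists_primcodable PartrecToTM2.Γ'
  have hsupp := TM1to0.tr_supports M₁ (TM2to1.tr_supports PartrecToTM2.tr
    (PartrecToTM2.tr_supports c .halt))
  set S := TM1to0.trStmts M₁ (TM2to1.trSupp PartrecToTM2.tr (PartrecToTM2.codeSupp c .halt))
  have hdef : (default : TM1to0.Λ' M₁) ∈ S := hsupp.1
  classical
  let Λ := {q : TM1to0.Λ' M₁ // q ∈ S}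
  let _ : Inhabited Λ := ⟨⟨default, hdef⟩⟩
  -- The full state type need not be finite, but the finite set `S` supports every run. States
  -- outside `S` go to a junk value that no run meets.
  let g : TM1to0.Λ' M₁ → Λ := fun q => if h : q ∈ S then ⟨q, h⟩ else default
  have hg : ∀ q ∈ S, (g q : TM1to0.Λ' M₁) = q := fun q hq => by simp [g, hq]
  let gp : PointedMap (TM1to0.Λ' M₁) Λ := ⟨g, by simp [g, hdef]; rfl⟩
  let M : TM0.Machine Γ Λ :=
    TM0.Machine.map M₀ (PointedMap.mk id rfl) (PointedMap.mk id rfl) g Subtype.val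
  refine ⟨Γ, Λ, inferInstance, inferInstance, hfin, inferInstance, pΓ, M,
    fun n => TM2to1.trInit PartrecToTM2.K'.main (PartrecToTM2.trList [n]), ?_, ?_⟩
  · refine (primrec_trInit PartrecToTM2.K'.main).comp ?_
    exact Primrec.list_append.comp primrec_trNat (Primrec.const [PartrecToTM2.Γ'.cons])
  · intro h
    refine hc (h.of_eq fun n => ?_)
    have hmap := TM0.Machine.map_respects M₀ (PointedMap.mk id rfl) (PointedMap.mk id rfl) gp
      Subtype.val hsupp (fun _ => rfl) hg
    have hM : (TM0.eval M (TM2to1.trInit PartrecToTM2.K'.main (PartrecToTM2.trList [n]))).Dom ↔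
        (TM0.eval M₀ (TM2to1.trInit PartrecToTM2.K'.main (PartrecToTM2.trList [n]))).Dom := by
      refine StateTransition.tr_eval_dom hmap ⟨hdef, ?_⟩
      refine (TM0.map_init (PointedMap.mk id rfl) gp _).trans ?_
      rw [show ∀ l : List Γ, l.map (PointedMap.mk id rfl : PointedMap Γ Γ) = l from List.map_id]
    refine hM.trans ?_
    rw [TM1to0.tr_eval]
    refine (TM2to1.tr_eval_dom PartrecToTM2.tr _ _).trans ?_
    change (StateTransition.eval _ (TM2.init PartrecToTM2.K'.main _)).Dom ↔ _
    have hinit : (TM2.init PartrecToTM2.K'.main (PartrecToTM2.trList [n]) :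
        PartrecToTM2.Cfg') = PartrecToTM2.init c [n] := by
      simp only [TM2.init, PartrecToTM2.init]
      congr 1
      funext k
      cases k <;> rfl
    rw [hinit, PartrecToTM2.tr_eval]
    rfl

/-! ### Reducing halting to `∼_o`, and the conclusion -/

theorem exists_finite_homogeneous_not_oConjDecidable :
    ∃ (k : ℕ) (rels : FreeMonoid (Fin k) → FreeMonoid (Fin k) → Prop),
      {p : FreeMonoid (Fin k) × FreeMonoid (Fin k) | rels p.1 p.2}.Finite ∧
      IsHomogeneousPresentation rels ∧ ¬ OConjDecidable rels := by
  obtain ⟨Γ, Λ, _, _, _, _, _, M, input, hinput, hM⟩ := exists_machine_undecidable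
  obtain ⟨k, ⟨e⟩⟩ := Finite.exists_equiv_fin (PaddedLetter (TapeLetter Γ Λ))
  refine ⟨k, transportRel e (PaddedRel (MachineRel M)),
    transportRel_finite _ _ (paddedRel_finite _ (machineRel_finite M)),
    transportRel_homogeneous _ _ (paddedRel_homogeneous _), fun hdec => hM ?_⟩
  let source : ℕ → List (Fin k) := fun n => (barWord (configWord [] (default : Λ) (input n)) 0).map e
  -- The initial configuration word has `|input| + 3` letters and the halting word has three, so
  -- `|input|` padding letters equalise the lengths.
  let target : ℕ → List (Fin k) := fun n =>
    (barWord (haltWord : List (TapeLetter Γ Λ)) (input n).length).map e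
  have hsource : Primrec source := by
    have h : Primrec fun n => [e bar, e (letter leftEnd), e (letter (state default))] ++
        (((input n).map fun a => e (letter (right a))) ++ [e (letter rightEnd)]) :=
      Primrec.list_append.comp (Primrec.const _) (Primrec.list_append.comp
        (Primrec.list_map hinput
          ((Primrec.dom_finite fun a => e (letter (right a))).comp Primrec.snd).to₂)
        (Primrec.const _))
    refine h.of_eq fun n => ?_
    simp [source, barWord, configWord, Function.comp_def]
  have htarget : Primrec target := by
    have h : Primrec fun n => [e bar, e (letter leftEnd), e (letter TapeLetter.halt),
        e (letter rightEnd)] ++ (input n).map fun _ => e pad :=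
      Primrec.list_append.comp (Primrec.const _)
        (Primrec.list_map hinput (Primrec.const _).to₂)
    refine h.of_eq fun n => ?_
    simp [target, barWord, haltWord]
  obtain ⟨f, hf, hfe⟩ := ComputablePred.computable_iff.1 hdec
  refine ComputablePred.computable_iff.2
    ⟨fun n => f (source n, target n), hf.comp (hsource.pair htarget).to_comp, ?_⟩
  funext n
  rw [← congrFun hfe (source n, target n)]
  refine propext ?_
  rw [← wordElt_configWord_eq_haltWord_iff, oConj_transport_iff, oConj_barWord_iff]
  simp [configWord, haltWord]
  omega

theorem hasDecidableRelations_of_finite {A : Type} [Primcodable A]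
    {rels : FreeMonoid A → FreeMonoid A → Prop}
    (h : {p : FreeMonoid A × FreeMonoid A | rels p.1 p.2}.Finite) :
    HasDecidableRelations rels := by
  let _ := Encodable.decidableEqOfEncodable A
  have h' : {p : List A × List A |
      rels (FreeMonoid.ofList p.1) (FreeMonoid.ofList p.2)}.Finite := h
  refine ComputablePred.computable_iff.2
    ⟨fun p => h'.toFinset.toList.any fun q => decide (q = p), ?_, ?_⟩
  · exact Computable.list_any (Computable.const _)
      (Primrec.eq.comp Primrec.snd Primrec.fst).decide.to_comp
  · funext p
    simp

theorem mainTheorem4 :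
    (∃ (M : Type) (_ : Monoid M), IsHomogeneousMonoid M ∧
      ¬ ∀ x y : M, PrimaryConjStar x y ↔ OConj x y) ∧
    (∀ (A : Type) [Finite A] [Primcodable A] (rels : FreeMonoid A → FreeMonoid A → Prop),
      IsHomogeneousPresentation rels → HasDecidableRelations rels →
        PrimaryConjStarDecidable rels) ∧
    (∃ (k : ℕ) (rels : FreeMonoid (Fin k) → FreeMonoid (Fin k) → Prop),
      {p : FreeMonoid (Fin k) × FreeMonoid (Fin k) | rels p.1 p.2}.Finite ∧
      IsHomogeneousPresentation rels ∧ ¬ OConjDecidable rels) := by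
  obtain ⟨k, rels, hfin, hR, hnot⟩ := exists_finite_homogeneous_not_oConjDecidable
  refine ⟨⟨PresentedMonoid rels, inferInstance, ⟨Fin k, rels, hR, ⟨MulEquiv.refl _⟩⟩,
    fun h => hnot ?_⟩, fun A _ _ rels hR hdec => primaryConjStarDecidable_of_homogeneous hR hdec,
    ⟨k, rels, hfin, hR, hnot⟩⟩
  -- If the relations agreed, the algorithm for `∼_p^*` would decide `∼_o`; the finite set of
  -- relations is decidable.
  exact (primaryConjStarDecidable_of_homogeneous hR
    (hasDecidableRelations_of_finite hfin)).of_eq fun p => h _ _
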